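/- Let $n$ agents have non-empty, convex, compact strategy sets $\mathcal S_i\subseteq\mathbb R^{n_i}$, put $\mathcal S=\prod_i \mathcal S_i$, and let $\Xi\subset\mathbb R^m$ be compact. Suppose that for each agent $i$ the utility $U_i:\mathcal S\times\Xi\to\mathbb R$, $(s,\xi)\mapsto U_i(s_i,s_{-i};\xi)$, is continuous, is concave in $s_i\in\mathcal S_i$ for all $s_{-i}$ and $\xi$, and is $L_i$-Lipschitz in $\xi\in\Xi$ for all $s$. Let $\mathcal M(\Xi)$ be the set of Borel probability distributions on $\Xi$ with finite first and second moments, and let $d_{\mathsf W}$ be the $1$-Wasserstein distance, $d_{\mathsf W}(\mathbb Q_1,\mathbb Q_2)=\inf_\pi\int\|\xi_1-\xi_2\|_1\,\pi(d\xi_1,d\xi_2)$, the infimum being over all couplings $\pi$ of $\mathbb Q_1$ and $\mathbb Q_2$. Let $\mathbb P^\star\in\mathcal M(\Xi)$. Let $h:\mathbb R^m\to\mathbb R^m$ be an observation map, let $\hat\xi^{(1)},\dots,\hat\xi^{(N)}\in\mathbb R^m$ ($N\ge 1$) be any (realization of the) samples, and put $\hat{\mathbb P}^N_h=\frac1N\sum_{k=1}^N\delta_{h(\hat\xi^{(k)})}$.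 For radii $\epsilon_i\ge 0$ put $\mathcal B_{\epsilon_i}(\hat{\mathbb P}^N_h)=\{\mathbb Q\in\mathcal M(\Xi): d_{\mathsf W}(\mathbb Q,\hat{\mathbb P}^N_h)\le\epsilon_i\}$. The stochastic game has strategy sets $\mathcal S_i$ and utilities $U^{S}_i(s)=\mathbb E_{\xi\sim\mathbb P^\star}[U_i(s;\xi)]$. The distributionally robust game has strategy sets $\mathcal S_i$ and utilities $$U^{DR}_i(s)=\inf_{\mathbb Q\in\mathcal B_{\epsilon_i}(\hat{\mathbb P}^N_h)}\mathbb E_{\xi\sim\mathbb Q}[U_i(s;\xi)],$$ where the infimum over an empty ball (possible only if some $h(\hat\xi^{(k)})\notin\Xi$) is $+\infty$. A Nash equilibrium of a game with utilities $u_i$ is a profile $s^\star\in\mathcal S$ with $u_i(s^\star_i,s^\star_{-i})\ge u_i(s_i,s^\star_{-i})$ for all $i$ and all $s_i\in\mathcal S_i$. Then the distributionally robust game has a non-empty set of Nash equilibria, and the stochastic game also has a non-empty set of Nash equilibria. -/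

import Mathlib

open MeasureTheory Set
open scoped ENNReal NNReal

noncomputable section

namespace DRGame

/-- Strategy profiles of `n` agents: the strategy of agent `i` is a vector of `ℝ^(d i)`. -/
abbrev Profile {n : ℕ} (d : Fin n → ℕ) : Type := ∀ i, EuclideanSpace ℝ (Fin (d i))

/-- A strategic form game with players `Fin n`: strategy sets `S i ⊆ ℝ^(d i)` and utilities with
values in an ordered set `R` (below `ℝ` or `[-∞, ∞]`). Only the values of the utilities on the
product of the strategy sets matter. -/
structure StrategicGame {n : ℕ} (d : Fin n → ℕ) (R : Type) where
  strategies : ∀ i, Set (EuclideanSpace ℝ (Fin (d i)))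
  utility : Fin n → Profile d → R

/-- The set of Nash equilibria: feasible profiles `s` such that no agent `i` can gain by
unilaterally switching from `s i` to another strategy `x` of its own. -/
def StrategicGame.nashEquilibria {n : ℕ} {d : Fin n → ℕ} {R : Type} [LE R]
    (G : StrategicGame d R) : Set (Profile d) :=
  {s | s ∈ Set.pi univ G.strategies ∧
    ∀ i, ∀ x ∈ G.strategies i, G.utility i (Function.update s i x) ≤ G.utility i s}

/-- `M(Ξ)`: the probability distributions on `Ξ` (viewed as probability measures on `ℝ^m` that give
no mass to the complement of `Ξ`) with finite first and second moments. -/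
def distributionsOn {m : ℕ} (Ξ : Set (EuclideanSpace ℝ (Fin m))) :
    Set (Measure (EuclideanSpace ℝ (Fin m))) :=
  {Q | IsProbabilityMeasure Q ∧ Q Ξᶜ = 0 ∧ ∫⁻ ξ, ‖ξ‖ₑ ∂Q < ∞ ∧ ∫⁻ ξ, ‖ξ‖ₑ ^ 2 ∂Q < ∞}

/-- The couplings of `Q₁` and `Q₂`: measures on the product with these marginals. -/
def couplings {m : ℕ} (Q₁ Q₂ : Measure (EuclideanSpace ℝ (Fin m))) :
    Set (Measure (EuclideanSpace ℝ (Fin m) × EuclideanSpace ℝ (Fin m))) :=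
  {π | π.map Prod.fst = Q₁ ∧ π.map Prod.snd = Q₂}

/-- The `1`-Wasserstein distance with transport cost `‖ξ₁ - ξ₂‖₁`, valued in `[0, ∞]`. -/
def wasserstein {m : ℕ} (Q₁ Q₂ : Measure (EuclideanSpace ℝ (Fin m))) : ℝ≥0∞ :=
  ⨅ π ∈ couplings Q₁ Q₂, ∫⁻ p, ENNReal.ofReal (∑ j, |p.1 j - p.2 j|) ∂π

/-- The closed Wasserstein ball of radius `ε` around `P`, within the distributions on `Ξ`. -/
def wassersteinBall {m : ℕ} (Ξ : Set (EuclideanSpace ℝ (Fin m)))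
    (P : Measure (EuclideanSpace ℝ (Fin m))) (ε : ℝ) :
    Set (Measure (EuclideanSpace ℝ (Fin m))) :=
  {Q | Q ∈ distributionsOn Ξ ∧ wasserstein Q P ≤ ENNReal.ofReal ε}

/-- The sample average distribution `(1/N) ∑ₖ δ_{h(ξₖ)}` of the observed samples. -/
def sampleAverage {m N : ℕ} (h : EuclideanSpace ℝ (Fin m) → EuclideanSpace ℝ (Fin m))
    (ξs : Fin N → EuclideanSpace ℝ (Fin m)) : Measure (EuclideanSpace ℝ (Fin m)) :=
  (N : ℝ≥0∞)⁻¹ • ∑ k, Measure.dirac (h (ξs k))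

/-- The stochastic game: each agent maximizes its expected utility under `P`. -/
def stochasticGame {n m : ℕ} {d : Fin n → ℕ} (S : ∀ i, Set (EuclideanSpace ℝ (Fin (d i))))
    (U : Fin n → Profile d → EuclideanSpace ℝ (Fin m) → ℝ)
    (P : Measure (EuclideanSpace ℝ (Fin m))) : StrategicGame d ℝ where
  strategies := S
  utility i s := ∫ ξ, U i s ξ ∂P

/-- The distributionally robust game: agent `i` maximizes the infimum of its expected utilities over
the Wasserstein ball of radius `ε i` around `P`. The infimum is taken in `[-∞, ∞]`, so that it is
the honest infimum in all cases (`+∞` if the ball is empty, which can only happen if `P` is not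
itself a distribution on `Ξ`). -/
def robustGame {n m : ℕ} {d : Fin n → ℕ} (S : ∀ i, Set (EuclideanSpace ℝ (Fin (d i))))
    (Ξ : Set (EuclideanSpace ℝ (Fin m)))
    (U : Fin n → Profile d → EuclideanSpace ℝ (Fin m) → ℝ)
    (P : Measure (EuclideanSpace ℝ (Fin m))) (ε : Fin n → ℝ) : StrategicGame d EReal where
  strategies := S
  utility i s := ⨅ Q ∈ wassersteinBall Ξ P (ε i), ((∫ ξ, U i s ξ ∂Q : ℝ) : EReal)

end DRGame

end

/-! Both games are instances of one game: agent `i` maximizes the infimum of its expected utility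
over a set of probability distributions on `Ξ`, either the Wasserstein ball or the singleton of
`Pstar`. Uniform continuity on a compact product makes the expectations equicontinuous in the
profile, uniformly over all distributions on `Ξ`, so their infimum is continuous; expectation and
infimum also preserve concavity in the own strategy. No compactness of the ball is needed.

Equilibria of continuous concave games (`exists_nash_equilibrium`) come from Ky Fan's inequality
`exists_forall_le_diag` for the Nikaido–Isoda function. Compactness reduces that inequality to
finitely many competitors, where Nash's improvement map on a simplex has a fixed point. Brouwer's
theorem for the simplex is in turn derived from Scarf's lemma `Scarf.exists_dominant_colorful`, a
parity argument in the style of Sperner with dominant sets in place of the cells of a triangulation.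
-/

namespace Scarf

/-! ### Scarf's lemma on dominant sets -/

/-- A set `σ` is dominant for a family of rankings `r` if every point `y` is ranked, by some
`r i`, weakly below all points of `σ`. -/
def Dominant {I T α : Type*} [LinearOrder α] (r : I → T → α) (σ : Finset T) : Prop :=
  ∀ y, ∃ i, ∀ x ∈ σ, r i y ≤ r i x

variable {I T α : Type*} [LinearOrder α] {r : I → T → α}

theorem Dominant.mono {σ τ : Finset T} (h : Dominant r σ) (hτ : τ ⊆ σ) : Dominant r τ := fun y =>
  let ⟨i, hi⟩ := h y
  ⟨i, fun x hx => hi x (hτ hx)⟩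

theorem exists_minimizers {σ : Finset T} (hσ : σ.Nonempty) :
    ∃ m : I → T, ∀ i, m i ∈ σ ∧ ∀ x ∈ σ, r i (m i) ≤ r i x := by
  choose m hm using fun i => σ.exists_min_image (r i) hσ
  exact ⟨m, hm⟩

/-- Apply dominance to the point `x` of `σ` itself. -/
theorem Dominant.exists_minimizer_eq (hr : ∀ i, Function.Injective (r i)) {σ : Finset T}
    (h : Dominant r σ) {m : I → T} (hm : ∀ i, m i ∈ σ ∧ ∀ x ∈ σ, r i (m i) ≤ r i x)
    {x : T} (hx : x ∈ σ) : ∃ i, m i = x := by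
  obtain ⟨i, hi⟩ := h x
  exact ⟨i, hr i (le_antisymm ((hm i).2 x hx) (hi _ (hm i).1))⟩

/-- For a set with one point less than there are rankings, some two rankings have the same
minimizer. -/
theorem exists_collision [Fintype I] {τ : Finset T} (hcard : τ.card + 1 = Fintype.card I) {m : I → T}
    (hm : ∀ i, m i ∈ τ ∧ ∀ x ∈ τ, r i (m i) ≤ r i x) :
    ∃ a b, a ≠ b ∧ m a = m b ∧ ∀ k, Set.InjOn m {k}ᶜ → k = a ∨ k = b := by
  obtain ⟨a, -, b, -, hab, hmab⟩ := Finset.exists_ne_map_eq_of_card_lt_of_maps_to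
    (s := Finset.univ) (t := τ) (f := m) (by rw [Finset.card_univ]; omega) (fun i _ => (hm i).1)
  refine ⟨a, b, hab, hmab, fun k hk => ?_⟩
  by_contra! hne
  exact hab (hk (by simpa using hne.1.symm) (by simpa using hne.2.symm) hmab)

/-- `y` is the best point for the ranking `k` among those that all the other rankings `i` place
strictly above `m i`. -/
def IsReplacement (r : I → T → α) (m : I → T) (k : I) (y : T) : Prop :=
  (∀ i, i ≠ k → r i (m i) < r i y) ∧ ∀ z, (∀ i, i ≠ k → r i (m i) < r i z) → r k z ≤ r k y

theorem exists_isReplacement [Finite T] {m : I → T} {k : I} {y : T}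
    (hy : ∀ i, i ≠ k → r i (m i) < r i y) : ∃ y, IsReplacement r m k y := by
  classical
  have := Fintype.ofFinite T
  obtain ⟨z, hz, hmax⟩ := Finset.exists_max_image
    (Finset.univ.filter fun z => ∀ i, i ≠ k → r i (m i) < r i z) (r k) ⟨y, by simpa using hy⟩
  exact ⟨z, by simpa using hz, fun w hw => hmax w (by simpa using hw)⟩

/-- Ranking `k` is spare, since its minimizer is also that of `l`. A point that some other ranking
places below its minimizer is still handled by that ranking; any other point can be dominated in `τ`
only through `k`, and `y` is the `k`-best of those. -/
theorem IsReplacement.notMem_and_dominant [DecidableEq T] (hr : ∀ i, Function.Injective (r i)) {τ : Finset T}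
    (h : Dominant r τ) {m : I → T} (hm : ∀ i, m i ∈ τ ∧ ∀ x ∈ τ, r i (m i) ≤ r i x)
    {k l : I} (hkl : k ≠ l) (hmkl : m k = m l) {y : T} (hy : IsReplacement r m k y) :
    y ∉ τ ∧ Dominant r (insert y τ) := by
  constructor
  · intro hyτ
    obtain ⟨j, rfl⟩ := h.exists_minimizer_eq hr hm hyτ
    by_cases hj : j = k
    · subst hj
      have := hy.1 l hkl.symm
      rw [hmkl] at this
      exact lt_irrefl _ this
    · exact lt_irrefl _ (hy.1 j hj)
  · intro z
    by_cases hz : ∃ i, i ≠ k ∧ r i z ≤ r i (m i)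
    · obtain ⟨i, hik, hi⟩ := hz
      refine ⟨i, fun x hx => ?_⟩
      rcases Finset.mem_insert.1 hx with rfl | hx
      · exact hi.trans (hy.1 i hik).le
      · exact hi.trans ((hm i).2 x hx)
    · push Not at hz
      refine ⟨k, fun x hx => ?_⟩
      rcases Finset.mem_insert.1 hx with rfl | hx
      · exact hy.2 z hz
      · obtain ⟨i, hi⟩ := h z
        by_cases hik : i = k
        · subst hik
          exact hi x hx
        · exact absurd (hi _ (hm i).1) (not_le.2 (hz i hik))

/-- Every point of the extension is a minimizer, and there are as many points as rankings, so
minimizers and rankings correspond bijectively. The ranking minimized at `y` is the required `k`;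
the others keep their minimizers from `τ`. -/
theorem exists_isReplacement_of_dominant_insert [Fintype I] [DecidableEq T]
    (hr : ∀ i, Function.Injective (r i))
    {τ : Finset T} (hcard : τ.card + 1 = Fintype.card I) {m : I → T}
    (hm : ∀ i, m i ∈ τ ∧ ∀ x ∈ τ, r i (m i) ≤ r i x)
    {y : T} (hyτ : y ∉ τ) (hy : Dominant r (insert y τ)) :
    ∃ k, IsReplacement r m k y ∧ Set.InjOn m {k}ᶜ := by
  obtain ⟨m', hm'⟩ := exists_minimizers (r := r) (Finset.insert_nonempty y τ)
  have hsurj : Finset.univ.image m' = insert y τ := by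
    ext x
    simp only [Finset.mem_image, Finset.mem_univ, true_and]
    refine ⟨?_, fun hx => hy.exists_minimizer_eq hr hm' hx⟩
    rintro ⟨i, rfl⟩
    exact (hm' i).1
  have hinj : Function.Injective m' := by
    rw [← Set.injOn_univ, ← Finset.coe_univ, ← Finset.card_image_iff, hsurj,
      Finset.card_insert_of_notMem hyτ, hcard, Finset.card_univ]
  obtain ⟨k, rfl⟩ := hy.exists_minimizer_eq hr hm' (Finset.mem_insert_self y τ)
  have hne : ∀ i, i ≠ k → m' i = m i := by
    intro i hik
    have hi : m' i ∈ τ := (Finset.mem_insert.1 (hm' i).1).resolve_left fun h => hik (hinj h)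
    exact hr i (le_antisymm ((hm' i).2 _ (Finset.mem_insert_of_mem (hm i).1)) ((hm i).2 _ hi))
  refine ⟨k, ⟨fun i hik => ?_, fun z hz => ?_⟩, fun i hi j hj hij => ?_⟩
  · rw [← hne i hik]
    exact lt_of_le_of_ne ((hm' i).2 _ (Finset.mem_insert_self _ _))
      fun h => hik (hinj (hr i h))
  · obtain ⟨i, hi⟩ := hy z
    by_cases hik : i = k
    · subst hik
      exact hi _ (Finset.mem_insert_self _ _)
    · exact absurd (hi _ (Finset.mem_insert_of_mem (hm i).1)) (not_le.2 (hz i hik))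
  · rw [← hne i hi, ← hne j hj] at hij
    exact hinj hij

/-- A dominant set of one point less than there are rankings has exactly two dominant extensions by
one point, provided that its minimizers can be improved upon. -/
theorem Dominant.card_insert_dominant_eq_two [Fintype I] [Fintype T] [DecidableEq T]
    (hr : ∀ i, Function.Injective (r i)) {τ : Finset T} (hτ : τ.Nonempty) (h : Dominant r τ)
    (hcard : τ.card + 1 = Fintype.card I)
    (hex : ∀ m : I → T, (∀ i, m i ∈ τ ∧ ∀ x ∈ τ, r i (m i) ≤ r i x) → ∀ k,
      ∃ y, ∀ i, i ≠ k → r i (m i) < r i y)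
    [DecidablePred fun σ : Finset T => σ.card = Fintype.card I ∧ Dominant r σ ∧ τ ⊆ σ] :
    (Finset.univ.filter fun σ : Finset T =>
      σ.card = Fintype.card I ∧ Dominant r σ ∧ τ ⊆ σ).card = 2 := by
  obtain ⟨m, hm⟩ := exists_minimizers (r := r) hτ
  obtain ⟨a, b, hab, hmab, huniq⟩ := exists_collision hcard hm
  obtain ⟨y, hy⟩ := (hex m hm a).elim fun _ h => exists_isReplacement h
  obtain ⟨z, hz⟩ := (hex m hm b).elim fun _ h => exists_isReplacement h
  obtain ⟨hyτ, hyd⟩ := hy.notMem_and_dominant hr h hm hab hmab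
  obtain ⟨hzτ, hzd⟩ := hz.notMem_and_dominant hr h hm hab.symm hmab.symm
  have hyz : y ≠ z := by
    rintro rfl
    obtain ⟨i, hi⟩ := h y
    have := hi _ (hm i).1
    by_cases hia : i = a
    · subst hia
      exact absurd this (not_le.2 (hz.1 i hab))
    · exact absurd this (not_le.2 (hy.1 i hia))
  rw [Finset.card_eq_two]
  -- The two extensions free one or the other of the two rankings sharing a minimizer.
  refine ⟨insert y τ, insert z τ, fun hins => ?_, ?_⟩
  · have : y ∈ insert z τ := hins ▸ Finset.mem_insert_self y τ
    exact (Finset.mem_insert.1 this).elim hyz hyτ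
  ext σ
  simp only [Finset.mem_filter, Finset.mem_univ, true_and, Finset.mem_insert,
    Finset.mem_singleton]
  constructor
  · rintro ⟨hσ, hσd, hsub⟩
    obtain ⟨w, hwτ, rfl⟩ := Finset.exists_eq_insert_iff.2 ⟨hsub, hcard.trans hσ.symm⟩
    obtain ⟨k, hk, hinj⟩ := exists_isReplacement_of_dominant_insert hr hcard hm hwτ hσd
    rcases huniq k hinj with rfl | rfl
    · left
      rw [hr k (le_antisymm (hy.2 w hk.1) (hk.2 y hy.1))]
    · right
      rw [hr k (le_antisymm (hz.2 w hk.1) (hk.2 z hz.1))]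
  · rintro (rfl | rfl)
    · exact ⟨by rw [Finset.card_insert_of_notMem hyτ, hcard], hyd, Finset.subset_insert _ _⟩
    · exact ⟨by rw [Finset.card_insert_of_notMem hzτ, hcard], hzd, Finset.subset_insert _ _⟩

/-- If `σ` has as many points as there are colors, but not all colors, then the number of its
facets whose colors are exactly the colors other than `i₀` is even. -/
theorem even_card_facets [Fintype I] [DecidableEq I] [Fintype T] [DecidableEq T]
    (c : T → I) (i₀ : I) {σ : Finset T}
    (hcard : σ.card = Fintype.card I) (hσ : σ.image c ≠ Finset.univ) :
    Even (Finset.univ.filter fun τ : Finset T =>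
      τ ⊆ σ ∧ τ.card + 1 = Fintype.card I ∧ τ.image c = Finset.univ.erase i₀).card := by
  rcases Finset.eq_empty_or_nonempty (Finset.univ.filter fun τ : Finset T =>
      τ ⊆ σ ∧ τ.card + 1 = Fintype.card I ∧ τ.image c = Finset.univ.erase i₀) with h | ⟨τ, hτ⟩
  · simp [h]
  simp only [Finset.mem_filter, Finset.mem_univ, true_and] at hτ
  obtain ⟨hsub, hτcard, hτc⟩ := hτ
  obtain ⟨x, hxτ, rfl⟩ := Finset.exists_eq_insert_iff.2 ⟨hsub, hτcard.trans hcard.symm⟩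
  have hinj : Set.InjOn c τ := by
    rw [← Finset.card_image_iff, hτc, Finset.card_erase_of_mem (Finset.mem_univ _),
      Finset.card_univ]
    omega
  have hcx : c x ≠ i₀ := by
    rintro rfl
    exact hσ (by rw [Finset.image_insert, hτc, Finset.insert_erase (Finset.mem_univ _)])
  obtain ⟨w, hwτ, hw⟩ : ∃ w ∈ τ, c w = c x := by
    rw [← Finset.mem_image, hτc]
    simpa using hcx
  have hwx : x ≠ w := fun h => hxτ (h ▸ hwτ)
  refine ⟨1, ?_⟩
  rw [Finset.card_eq_two]
  -- Only `x` and `w` share a color, so a facet with the right colors omits one of these two.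
  refine ⟨τ, insert x (τ.erase w), fun h => hxτ (h ▸ Finset.mem_insert_self _ _), ?_⟩
  ext ρ
  simp only [Finset.mem_filter, Finset.mem_univ, true_and, Finset.mem_insert,
    Finset.mem_singleton]
  constructor
  · rintro ⟨hρ, hρcard, hρc⟩
    obtain ⟨y, hyρ, hy⟩ := Finset.exists_eq_insert_iff.2 ⟨hρ, hρcard.trans hcard.symm⟩
    have hρy : ρ = (insert x τ).erase y := by rw [← hy, Finset.erase_insert hyρ]
    have hymem : y ∈ insert x τ := hy ▸ Finset.mem_insert_self _ _
    by_cases hyx : y = x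
    · left
      rw [hρy, hyx, Finset.erase_insert hxτ]
    right
    have hyτ : y ∈ τ := (Finset.mem_insert.1 hymem).resolve_left hyx
    have : c y ∈ ρ.image c := by
      rw [hρc, ← hτc]
      exact Finset.mem_image_of_mem _ hyτ
    obtain ⟨v, hvρ, hv⟩ := Finset.mem_image.1 this
    have hvy : v ≠ y := fun h => hyρ (h ▸ hvρ)
    rcases Finset.mem_insert.1 (hρ hvρ) with rfl | hvτ
    · have : w = y := hinj hwτ hyτ (hw.trans hv)
      subst this
      rw [hρy, Finset.erase_insert_of_ne hwx]
    · exact absurd (hinj hvτ hyτ hv) hvy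
  · rintro (rfl | rfl)
    · exact ⟨Finset.subset_insert _ _, hτcard, hτc⟩
    · refine ⟨Finset.insert_subset_insert _ (Finset.erase_subset _ _), ?_, ?_⟩
      · rw [Finset.card_insert_of_notMem (fun h => hxτ (Finset.mem_of_mem_erase h)),
          Finset.card_erase_add_one hwτ, hτcard]
      · rw [Finset.image_insert, ← hw, ← Finset.image_insert, Finset.insert_erase hwτ, hτc]

/-- This is the boundary cell where parity breaks. A slack point `sl j` is the strict minimum of
ranking `j`, so only `i₀` can dominate points outside `τ`; hence the added point must be the
`i₀`-best one outside `τ`. -/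
theorem card_dominant_superset_slacks [Fintype I] [DecidableEq I] [Fintype T] [DecidableEq T]
    {sl : I → T} (hbot : ∀ i t, t ≠ sl i → r i (sl i) < r i t)
    (htop : ∀ i j t, j ≠ i → t ∉ Set.range sl → r i t < r i (sl j))
    (hr : ∀ i, Function.Injective (r i)) (hsl : Function.Injective sl) (i₀ : I)
    [DecidablePred fun σ : Finset T =>
      σ.card = Fintype.card I ∧ Dominant r σ ∧ (Finset.univ.erase i₀).image sl ⊆ σ] :
    (Finset.univ.filter fun σ : Finset T => σ.card = Fintype.card I ∧ Dominant r σ ∧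
      (Finset.univ.erase i₀).image sl ⊆ σ).card = 1 := by
  set τ := (Finset.univ.erase i₀).image sl with hτ
  have hmem : ∀ j, j ≠ i₀ → sl j ∈ τ := fun j hj =>
    Finset.mem_image_of_mem _ (by simpa using hj)
  have hmem' : ∀ t ∈ τ, ∃ j, j ≠ i₀ ∧ sl j = t := fun t ht => by simpa [hτ] using ht
  have hcard : τ.card + 1 = Fintype.card I := by
    rw [hτ, Finset.card_image_of_injective _ hsl, Finset.card_erase_add_one (Finset.mem_univ _),
      Finset.card_univ]
  have hi₀ : sl i₀ ∉ τ := fun h => by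
    obtain ⟨j, hj, h⟩ := hmem' _ h
    exact hj (hsl h)
  obtain ⟨y, hy, hmax⟩ := Finset.exists_max_image τᶜ (r i₀) ⟨sl i₀, by simpa using hi₀⟩
  rw [Finset.mem_compl] at hy
  have hdom : Dominant r (insert y τ) := by
    intro z
    by_cases hz : z ∈ τ
    · obtain ⟨j, -, rfl⟩ := hmem' z hz
      refine ⟨j, fun x _ => ?_⟩
      by_cases hx : x = sl j
      · rw [hx]
      · exact (hbot j x hx).le
    · refine ⟨i₀, fun x hx => ?_⟩
      rcases Finset.mem_insert.1 hx with rfl | hx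
      · exact hmax z (Finset.mem_compl.2 hz)
      · obtain ⟨j, hj, rfl⟩ := hmem' x hx
        by_cases hzr : z ∈ Set.range sl
        · obtain ⟨k, rfl⟩ := hzr
          by_cases hk : k = i₀
          · subst hk
            exact (hbot k _ (fun h => hj (hsl h))).le
          · exact absurd (hmem k hk) hz
        · exact (htop i₀ j z hj hzr).le
  rw [Finset.card_eq_one]
  refine ⟨insert y τ, ?_⟩
  ext σ
  simp only [Finset.mem_filter, Finset.mem_univ, true_and, Finset.mem_singleton]
  constructor
  · rintro ⟨hσ, hσd, hsub⟩
    obtain ⟨w, hwτ, rfl⟩ := Finset.exists_eq_insert_iff.2 ⟨hsub, hcard.trans hσ.symm⟩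
    obtain ⟨i, hi⟩ := hσd y
    have hii : i = i₀ := by
      by_contra hii
      have := hi _ (Finset.mem_insert_of_mem (hmem i hii))
      exact absurd this (not_le.2 (hbot i y fun h => hy (h ▸ hmem i hii)))
    subst hii
    rw [hr i (le_antisymm (hi w (Finset.mem_insert_self _ _)) (hmax w (Finset.mem_compl.2 hwτ)))]
  · rintro rfl
    exact ⟨by rw [Finset.card_insert_of_notMem hy, hcard], hdom, Finset.subset_insert _ _⟩

/-- **Scarf's lemma**: given rankings of a finite set with slack points, and a coloring that gives
each slack point its own color, there is a dominant set that has all colors. -/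
theorem exists_dominant_colorful [Finite I] [Finite T] [Nonempty I]
    {sl : I → T} (hbot : ∀ i t, t ≠ sl i → r i (sl i) < r i t)
    (htop : ∀ i j t, j ≠ i → t ∉ Set.range sl → r i t < r i (sl j))
    (hr : ∀ i, Function.Injective (r i)) (c : T → I) (hc : ∀ i, c (sl i) = i) :
    ∃ σ : Finset T, Dominant r σ ∧ ∀ i, ∃ x ∈ σ, c x = i := by
  classical
  have := Fintype.ofFinite I
  have := Fintype.ofFinite T
  have hsl : Function.Injective sl := fun i j h => by rw [← hc i, h, hc j]
  obtain ⟨i₀⟩ := ‹Nonempty I›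
  by_contra! hno
  let D : Finset (Finset T) := Finset.univ.filter fun τ =>
    τ.card + 1 = Fintype.card I ∧ τ.image c = Finset.univ.erase i₀
  let R : Finset (Finset T) := Finset.univ.filter fun σ => σ.card = Fintype.card I ∧ Dominant r σ
  -- Count the pairs `τ ⊆ σ` in two ways: without a colorful `σ` every column is even, while every
  -- row is even except that of the slack set `τ₀`, which is one.
  have key := Finset.sum_card_bipartiteAbove_eq_sum_card_bipartiteBelow
    (s := D) (t := R) (fun τ σ : Finset T => τ ⊆ σ)
  have hR : Even (∑ σ ∈ R, (D.bipartiteBelow (fun τ σ : Finset T => τ ⊆ σ) σ).card) := by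
    refine Finset.even_sum _ fun σ hσ => ?_
    simp only [R, Finset.mem_filter, Finset.mem_univ, true_and] at hσ
    have hbelow : D.bipartiteBelow (fun τ σ : Finset T => τ ⊆ σ) σ = Finset.univ.filter
        fun τ : Finset T =>
          τ ⊆ σ ∧ τ.card + 1 = Fintype.card I ∧ τ.image c = Finset.univ.erase i₀ := by
      ext τ
      simp [D, Finset.bipartiteBelow, and_comm]
    rw [hbelow]
    refine even_card_facets c i₀ hσ.1 fun h => ?_
    obtain ⟨i, hi⟩ := hno σ hσ.2
    obtain ⟨x, hx, hxi⟩ := Finset.mem_image.1 (h ▸ Finset.mem_univ i : i ∈ σ.image c)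
    exact hi x hx hxi
  set τ₀ := (Finset.univ.erase i₀).image sl with hτ₀
  have hτ₀D : τ₀ ∈ D := by
    simp only [D, Finset.mem_filter, Finset.mem_univ, true_and]
    constructor
    · rw [hτ₀, Finset.card_image_of_injective _ hsl,
        Finset.card_erase_add_one (Finset.mem_univ _), Finset.card_univ]
    · rw [hτ₀, Finset.image_image, show c ∘ sl = id from funext hc, Finset.image_id]
  have habove : ∀ τ, R.bipartiteAbove (fun τ σ : Finset T => τ ⊆ σ) τ = Finset.univ.filter
      fun σ : Finset T => σ.card = Fintype.card I ∧ Dominant r σ ∧ τ ⊆ σ := by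
    intro τ
    ext σ
    simp [R, Finset.bipartiteAbove, and_assoc]
  have hone : (R.bipartiteAbove (fun τ σ : Finset T => τ ⊆ σ) τ₀).card = 1 := by
    rw [habove]
    exact card_dominant_superset_slacks hbot htop hr hsl i₀
  have heven : Even (∑ τ ∈ D.erase τ₀,
      (R.bipartiteAbove (fun τ σ : Finset T => τ ⊆ σ) τ).card) := by
    refine Finset.even_sum _ fun τ hτ => ?_
    simp only [D, Finset.mem_erase, Finset.mem_filter, Finset.mem_univ, true_and] at hτ
    obtain ⟨hne, hcard, hcτ⟩ := hτ
    rw [habove]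
    by_cases hd : Dominant r τ
    · obtain ⟨t, htτ, ht⟩ : ∃ t ∈ τ, t ∉ Set.range sl := by
        by_contra! hall
        refine hne (Finset.eq_of_subset_of_card_le (fun t ht => ?_) ?_)
        · obtain ⟨j, rfl⟩ := hall t ht
          have : c (sl j) ∈ τ.image c := Finset.mem_image_of_mem _ ht
          rw [hcτ, hc] at this
          exact Finset.mem_image_of_mem _ this
        · have := (Finset.mem_filter.1 hτ₀D).2.1
          omega
      rw [hd.card_insert_dominant_eq_two hr ⟨t, htτ⟩ hcard
        fun m hm k => ⟨sl k, fun i hi => ((hm i).2 t htτ).trans_lt (htop i k t hi.symm ht)⟩]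
      exact even_two
    · rw [Finset.filter_false_of_mem fun σ _ h => hd (h.2.1.mono h.2.2)]
      simp
  rw [← key, ← Finset.add_sum_erase _ _ hτ₀D, hone] at hR
  exact absurd hR (by rw [Nat.not_even_iff_odd]; exact odd_one.add_even heven)

end Scarf

/-! ### Brouwer's fixed point theorem on the simplex -/

namespace Scarf

/-- Among finitely many points `p` of the standard simplex that form a `ρ`-net, colored by
coordinates, some points near each other represent every color `i` except those for which the
`i`-th coordinate is near `0`. -/
theorem exists_near_colorful {I : Type*} [Fintype I] [Nonempty I] {T : Type*} [Finite T]
    (p : T → I → ℝ) (hp : ∀ t, p t ∈ stdSimplex ℝ I) {ρ : ℝ}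
    (hnet : ∀ x ∈ stdSimplex ℝ I, ∃ t, dist x (p t) < ρ) (c : T → I) :
    ∃ X : Set T, X.Nonempty ∧ ∃ m : I → ℝ, (∀ t ∈ X, ∀ i, m i ≤ p t i) ∧
      1 - ∑ i, m i ≤ Fintype.card I * ρ ∧ ∀ i, m i = 0 ∨ ∃ t ∈ X, c t = i := by
  classical
  obtain ⟨K, ⟨e⟩⟩ := Finite.exists_equiv_fin (I ⊕ T)
  -- The values `-1` and `2` lie outside `[0, 1]`, so slack points are extreme; the lexicographic
  -- second entry in `r` breaks ties.
  let q : I → I ⊕ T → ℝ := fun i => Sum.elim (fun j => if j = i then -1 else 2) (fun t => p t i)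
  let r : I → I ⊕ T → ℝ ×ₗ Fin K := fun i x => toLex (q i x, e x)
  have hlt : ∀ {i x y}, q i x < q i y → r i x < r i y := fun h => Prod.Lex.toLex_lt_toLex.2 (.inl h)
  have hle : ∀ {i x y}, r i x ≤ r i y → q i x ≤ q i y := fun {i x y} h =>
    not_lt.1 fun h' => absurd h (not_le.2 (hlt h'))
  have hp1 : ∀ t i, p t i ≤ 1 := fun t i => by
    rw [← (hp t).2]
    exact Finset.single_le_sum (fun j _ => (hp t).1 j) (Finset.mem_univ i)
  obtain ⟨σ, hσ, hcol⟩ := exists_dominant_colorful (r := r) (sl := Sum.inl)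
    (fun i t ht => hlt (by
      rcases t with j | t
      · have : j ≠ i := fun h => ht (h ▸ rfl)
        simp [q, this]
        norm_num
      · have := (hp t).1 i
        simp only [q, Sum.elim_inl, Sum.elim_inr, if_true]
        linarith))
    (fun i j t hj ht => hlt (by
      rcases t with k | t
      · exact absurd ⟨k, rfl⟩ ht
      · have := hp1 t i
        simp only [q, Sum.elim_inl, Sum.elim_inr, if_neg hj]
        linarith))
    (fun i x y h => by
      have : e x = e y := congrArg (fun z => (ofLex z).2) h
      exact e.injective this)
    (Sum.elim id c) (fun i => rfl)
  have hslack : ∀ {i t}, Sum.inl i ∈ σ → ¬ ∀ x ∈ σ, r i (Sum.inr t) ≤ r i x := fun {i t} hi h => by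
    have h1 := hle (h _ hi)
    have h2 := (hp t).1 i
    simp only [q, Sum.elim_inl, Sum.elim_inr, if_true] at h1
    linarith
  have hreal : ∀ i, Sum.inl i ∉ σ → ∃ t, Sum.inr t ∈ σ ∧ c t = i := fun i hi => by
    obtain ⟨x | t, hx, hxi⟩ := hcol i
    · exact absurd ((show x = i from hxi) ▸ hx) hi
    · exact ⟨t, hx, hxi⟩
  have hmin : ∀ i, ∃ μ : ℝ, (∀ t, Sum.inr t ∈ σ → μ ≤ p t i) ∧
      ((Sum.inl i ∈ σ ∧ μ = 0) ∨
        (Sum.inl i ∉ σ ∧ ∃ t, Sum.inr t ∈ σ ∧ p t i = μ)) := fun i => by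
    by_cases hi : Sum.inl i ∈ σ
    · exact ⟨0, fun t _ => (hp t).1 i, .inl ⟨hi, rfl⟩⟩
    · obtain ⟨t, ht, hmin⟩ := Set.exists_min_image {t | Sum.inr t ∈ σ} (fun t => p t i)
        (Set.toFinite _) ((hreal i hi).imp fun _ h => h.1)
      exact ⟨p t i, hmin, .inr ⟨hi, t, ht, rfl⟩⟩
  choose m hm hm' using hmin
  have hndom : ∀ t, ∃ i, p t i ≤ m i := fun t => by
    obtain ⟨i, hi⟩ := hσ (Sum.inr t)
    rcases hm' i with ⟨hiσ, -⟩ | ⟨-, t', ht', h⟩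
    · exact absurd hi (hslack hiσ)
    · exact ⟨i, h ▸ hle (hi _ ht')⟩
  obtain ⟨t₀, -⟩ := hnet _ (single_mem_stdSimplex ℝ (Classical.arbitrary I))
  obtain ⟨t₁, ht₁⟩ : ∃ t, Sum.inr t ∈ σ := by
    obtain ⟨i, hi⟩ := hσ (Sum.inr t₀)
    exact (hreal i fun h => hslack h hi).imp fun _ h => h.1
  have hcard : (0 : ℝ) < Fintype.card I := by exact_mod_cast Fintype.card_pos
  refine ⟨{t | Sum.inr t ∈ σ}, ⟨t₁, ht₁⟩, m, fun t ht i => hm i t ht, ?_, fun i => ?_⟩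
  · by_contra! hcon
    -- Spreading the missing mass evenly puts `m + κ` in the simplex. If `ρ < κ`, a net point near
    -- it exceeds `m` in every coordinate, against `hndom`.
    set κ := (1 - ∑ i, m i) / Fintype.card I with hκ
    have hκρ : ρ < κ := by rwa [hκ, lt_div_iff₀ hcard, mul_comm]
    have hm0 : ∀ i, 0 ≤ m i := fun i => by
      rcases hm' i with ⟨-, h⟩ | ⟨-, t, -, h⟩
      · exact h.ge
      · exact h ▸ (hp t).1 i
    have hκ0 : 0 ≤ κ := by
      refine div_nonneg (sub_nonneg.2 ?_) hcard.le
      rw [← (hp t₁).2]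
      exact Finset.sum_le_sum fun i _ => hm i t₁ ht₁
    obtain ⟨t, ht⟩ := hnet (fun i => m i + κ) ⟨fun i => add_nonneg (hm0 i) hκ0, by
      rw [Finset.sum_add_distrib, Finset.sum_const, Finset.card_univ, nsmul_eq_mul, hκ,
        mul_div_cancel₀ _ hcard.ne']
      ring⟩
    obtain ⟨i, hi⟩ := hndom t
    have : m i + κ - p t i < ρ := (abs_lt.1 ((dist_le_pi_dist _ _ i).trans_lt ht)).2
    linarith
  · by_cases hi : Sum.inl i ∈ σ
    · left
      rcases hm' i with ⟨-, h⟩ | ⟨h, -⟩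
      · exact h
      · exact absurd hi h
    · exact .inr (hreal i hi)

end Scarf

/-- A continuous self-map of the standard simplex decreases no coordinate by more than `δ`, at
some point. -/
theorem exists_forall_sub_le_of_mapsTo_stdSimplex {I : Type*} [Fintype I] [Nonempty I]
    {f : (I → ℝ) → I → ℝ} (hf : ContinuousOn f (stdSimplex ℝ I))
    (hmaps : MapsTo f (stdSimplex ℝ I) (stdSimplex ℝ I)) {δ : ℝ} (hδ : 0 < δ) :
    ∃ x ∈ stdSimplex ℝ I, ∀ i, x i - δ ≤ f x i := by
  have hcomp := isCompact_stdSimplex ℝ I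
  obtain ⟨η, hη, huc⟩ := Metric.uniformContinuousOn_iff.1
    (hcomp.uniformContinuousOn_of_continuous hf) (δ / 2) (half_pos hδ)
  have hcard : (0 : ℝ) < Fintype.card I := by exact_mod_cast Fintype.card_pos
  set θ := min η δ / 2 with hθ
  have hθ0 : 0 < θ := by positivity
  have hθη : θ < η := by have := min_le_left η δ; linarith
  have hθδ : θ ≤ δ / 2 := by have := min_le_right η δ; linarith
  obtain ⟨T, hTsub, hTfin, hTcov⟩ := hcomp.finite_cover_balls (div_pos hθ0 hcard)
  have : Finite T := hTfin
  have hcolor : ∀ t : T, ∃ i, t.1 i ≤ f t.1 i := fun t => by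
    obtain ⟨i, -, hi⟩ := Finset.exists_le_of_sum_le (s := Finset.univ) (f := t.1) (g := f t.1)
      Finset.univ_nonempty (by rw [(hTsub t.2).2, (hmaps (hTsub t.2)).2])
    -- Both points have coordinate sum one, so `f` fails to decrease some coordinate; this is the
    -- color.
    exact ⟨i, hi⟩
  choose c hc using hcolor
  obtain ⟨X, ⟨x, hx⟩, m, hm, hsum, hcol⟩ := Scarf.exists_near_colorful (fun t : T => t.1)
    (fun t => hTsub t.2) (ρ := θ / Fintype.card I) (fun x hx => by
      obtain ⟨t, ht, h⟩ := mem_iUnion₂.1 (hTcov hx)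
      exact ⟨⟨t, ht⟩, h⟩) c
  rw [mul_div_cancel₀ _ hcard.ne'] at hsum
  have hnear : ∀ t ∈ X, ∀ i, t.1 i - m i ≤ θ := fun t ht i => by
    refine le_trans ?_ hsum
    rw [← (hTsub t.2).2, ← Finset.sum_sub_distrib]
    exact Finset.single_le_sum (f := fun i => t.1 i - m i)
      (fun j _ => sub_nonneg.2 (hm t ht j)) (Finset.mem_univ i)
  refine ⟨x, hTsub x.2, fun i => ?_⟩
  have hxi := hnear x hx i
  -- Either `x i ≤ θ`, so the bound is below zero, or a point of color `i` near `x` passes on its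
  -- inequality at a cost of `θ` and `δ / 2`.
  rcases hcol i with hi | ⟨t, ht, rfl⟩
  · have := (hmaps (hTsub x.2)).1 i
    linarith
  · have hdist : dist t.1 x.1 < η := (dist_pi_lt_iff hη).2 fun j => by
      have h1 := hnear x hx j
      have h2 := hnear t ht j
      have h3 := hm x hx j
      have h4 := hm t ht j
      rw [Real.dist_eq, abs_lt]
      constructor <;> linarith
    have h1 := (abs_lt.1 ((dist_le_pi_dist _ _ (c t)).trans_lt
      (huc _ (hTsub t.2) _ (hTsub x.2) hdist))).2
    have h2 := hc t
    have h3 := hm t ht (c t)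
    linarith

/-- **Brouwer's fixed point theorem** for the standard simplex. -/
theorem exists_fixedPoint_stdSimplex {I : Type*} [Fintype I] [Nonempty I]
    {f : (I → ℝ) → I → ℝ} (hf : ContinuousOn f (stdSimplex ℝ I))
    (hmaps : MapsTo f (stdSimplex ℝ I) (stdSimplex ℝ I)) :
    ∃ x ∈ stdSimplex ℝ I, f x = x := by
  have hcomp := isCompact_stdSimplex ℝ I
  obtain ⟨x, hx, hmin⟩ : ∃ x ∈ stdSimplex ℝ I, ∀ i, x i ≤ f x i := by
    choose u hu hu' using fun k : ℕ => exists_forall_sub_le_of_mapsTo_stdSimplex hf hmaps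
      (Nat.one_div_pos_of_nat (α := ℝ) (n := k))
    obtain ⟨x, hx, φ, hφ, hlim⟩ := hcomp.tendsto_subseq hu
    refine ⟨x, hx, fun i => ?_⟩
    have h1 : Filter.Tendsto (fun k => f (u (φ k))) Filter.atTop (nhds (f x)) :=
      (hf x hx).tendsto.comp (tendsto_nhdsWithin_iff.2 ⟨hlim, .of_forall fun k => hu _⟩)
    have h2 : Filter.Tendsto (fun k => u (φ k) i - 1 / ((φ k : ℝ) + 1)) Filter.atTop
        (nhds (x i - 0)) :=
      ((tendsto_pi_nhds.1 hlim) i).sub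
        ((tendsto_one_div_add_atTop_nhds_zero_nat (𝕜 := ℝ)).comp hφ.tendsto_atTop)
    rw [sub_zero] at h2
    exact le_of_tendsto_of_tendsto' h2 ((tendsto_pi_nhds.1 h1) i) fun k => hu' _ i
  refine ⟨x, hx, funext fun i => ?_⟩
  exact ((Finset.sum_eq_sum_iff_of_le fun i _ => hmin i).1
    (by rw [hx.2, (hmaps hx).2]) i (Finset.mem_univ i)).symm

/-! ### Ky Fan's inequality and Nash equilibria -/

/-- Nash's map shifts weight towards the `y i` that improve on the barycenter `b w`. At a fixed
point with some gain, positive weight sits only on strict improvements, so the average gain is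
positive, contradicting concavity by Jensen. -/
theorem exists_forall_le_diag_of_finite {E : Type*} [AddCommGroup E] [Module ℝ E]
    [TopologicalSpace E] [ContinuousAdd E] [ContinuousSMul ℝ E] {K : Set E} (hK : Convex ℝ K)
    {F : E → E → ℝ} (hF : ContinuousOn (fun p : E × E => F p.1 p.2) (K ×ˢ K))
    (hconc : ∀ x ∈ K, ConcaveOn ℝ K (F x)) {I : Type*} [Finite I] [Nonempty I]
    (y : I → E) (hy : ∀ i, y i ∈ K) : ∃ x ∈ K, ∀ i, F x (y i) ≤ F x x := by
  have := Fintype.ofFinite I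
  let b : (I → ℝ) → E := fun w => ∑ i, w i • y i
  have hb : Continuous b := by fun_prop
  have hbK : MapsTo b (stdSimplex ℝ I) K := fun w hw =>
    hK.sum_mem (fun i _ => hw.1 i) hw.2 fun i _ => hy i
  let g : (I → ℝ) → I → ℝ := fun w i => max 0 (F (b w) (y i) - F (b w) (b w))
  have hg0 : ∀ w i, 0 ≤ g w i := fun w i => le_max_left _ _
  have hG0 : ∀ w, 0 < 1 + ∑ i, g w i := fun w =>
    add_pos_of_pos_of_nonneg one_pos (Finset.sum_nonneg fun i _ => hg0 w i)
  have hg : ∀ i, ContinuousOn (fun w => g w i) (stdSimplex ℝ I) := fun i =>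
    continuousOn_const.sup <|
      (hF.comp (f := fun w => (b w, y i)) (by fun_prop) fun w hw => ⟨hbK hw, hy i⟩).sub
        (hF.comp (f := fun w => (b w, b w)) (by fun_prop) fun w hw => ⟨hbK hw, hbK hw⟩)
  obtain ⟨w, hw, hfix⟩ := exists_fixedPoint_stdSimplex
    (f := fun w i => (w i + g w i) / (1 + ∑ j, g w j))
    (continuousOn_pi.2 fun i => ((continuous_apply i).continuousOn.add (hg i)).div
      (continuousOn_const.add (continuousOn_finsetSum _ fun j _ => hg j))
      fun w _ => (hG0 w).ne')
    (fun w hw => ⟨fun i => div_nonneg (add_nonneg (hw.1 i) (hg0 w i)) (hG0 w).le, by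
      rw [← Finset.sum_div, Finset.sum_add_distrib, hw.2, div_self (hG0 w).ne']⟩)
  have hwg : ∀ i, w i * ∑ j, g w j = g w i := fun i => by
    have := congrFun hfix i
    rw [div_eq_iff (hG0 w).ne'] at this
    linarith
  refine ⟨b w, hbK hw, fun i => ?_⟩
  by_contra! hi
  have hG : 0 < ∑ j, g w j :=
    (lt_max_of_lt_right (sub_pos.2 hi)).trans_le
      (Finset.single_le_sum (f := g w) (fun j _ => hg0 w j) (Finset.mem_univ i))
  have hmul : ∀ i, w i * (F (b w) (y i) - F (b w) (b w)) = w i * g w i := fun i => by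
    rcases le_total 0 (F (b w) (y i) - F (b w) (b w)) with h | h
    · rw [show g w i = _ from max_eq_right h]
    · have h0 : g w i = 0 := max_eq_left h
      rw [(mul_eq_zero.1 ((hwg i).trans h0)).resolve_right hG.ne', zero_mul, zero_mul]
  have hjensen : ∑ i, w i * g w i ≤ 0 := by
    have := (hconc _ (hbK hw)).le_map_sum (t := Finset.univ) (w := w) (p := y)
      (fun i _ => hw.1 i) hw.2 fun i _ => hy i
    simp only [← hmul, mul_sub, Finset.sum_sub_distrib, ← Finset.sum_mul, hw.2, one_mul]
    simpa only [smul_eq_mul, sub_nonpos] using this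
  have hwi : 0 < w i := by
    refine (hw.1 i).lt_of_ne fun h0 => ?_
    have := hwg i
    rw [← h0, zero_mul] at this
    exact (lt_max_of_lt_right (sub_pos.2 hi)).ne this
  exact absurd hjensen (not_le.2 ((mul_pos hwi (lt_max_of_lt_right (sub_pos.2 hi))).trans_le
    (Finset.single_le_sum (f := fun i => w i * g w i)
      (fun j _ => mul_nonneg (hw.1 j) (hg0 w j)) (Finset.mem_univ i))))

/-- **Ky Fan's inequality** for jointly continuous functions that are concave in the second
argument. -/
theorem exists_forall_le_diag {E : Type*} [AddCommGroup E] [Module ℝ E]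
    [TopologicalSpace E] [T2Space E] [ContinuousAdd E] [ContinuousSMul ℝ E] {K : Set E}
    (hK : Convex ℝ K) (hKc : IsCompact K) (hne : K.Nonempty)
    {F : E → E → ℝ} (hF : ContinuousOn (fun p : E × E => F p.1 p.2) (K ×ˢ K))
    (hconc : ∀ x ∈ K, ConcaveOn ℝ K (F x)) : ∃ x ∈ K, ∀ y ∈ K, F x y ≤ F x x := by
  have hcl : ∀ y : K, IsClosed {x ∈ K | F x y ≤ F x x} := fun y =>
    hKc.isClosed.isClosed_le
      (hF.comp (f := fun x => (x, (y : E))) (by fun_prop) fun x hx => ⟨hx, y.2⟩)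
      (hF.comp (f := fun x => (x, x)) (by fun_prop) fun x hx => ⟨hx, hx⟩)
  obtain ⟨x, hxK, hx⟩ := hKc.inter_iInter_nonempty _ hcl fun u => by
    rcases u.eq_empty_or_nonempty with rfl | ⟨z, hz⟩
    · simpa using hne
    · have : Nonempty u := ⟨z, hz⟩
      obtain ⟨x, hxK, hx⟩ := exists_forall_le_diag_of_finite hK hF hconc
        (fun i : u => (i.1 : E)) fun i => i.1.2
      exact ⟨x, hxK, mem_iInter₂.2 fun i hi => ⟨hxK, hx ⟨i, hi⟩⟩⟩
  exact ⟨x, hxK, fun y hy => (mem_iInter.1 hx ⟨y, hy⟩).2⟩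

/-- Existence of Nash equilibria for continuous utilities that are concave in the own strategy. -/
theorem exists_nash_equilibrium {ι : Type*} [Fintype ι] [DecidableEq ι] {E : ι → Type*}
    [∀ i, AddCommGroup (E i)] [∀ i, Module ℝ (E i)] [∀ i, TopologicalSpace (E i)]
    [∀ i, T2Space (E i)] [∀ i, ContinuousAdd (E i)] [∀ i, ContinuousSMul ℝ (E i)]
    {S : ∀ i, Set (E i)} (hne : ∀ i, (S i).Nonempty) (hconv : ∀ i, Convex ℝ (S i))
    (hcomp : ∀ i, IsCompact (S i)) {u : ι → (∀ i, E i) → ℝ}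
    (hu : ∀ i, ContinuousOn (u i) (univ.pi S))
    (hconc : ∀ i, ∀ s ∈ univ.pi S, ConcaveOn ℝ (S i) fun x => u i (Function.update s i x)) :
    ∃ s ∈ univ.pi S, ∀ i, ∀ x ∈ S i, u i (Function.update s i x) ≤ u i s := by
  have hupd : ∀ s ∈ univ.pi S, ∀ i, ∀ x ∈ S i, Function.update s i x ∈ univ.pi S :=
    fun s hs i x hx => update_mem_pi_iff_of_mem hs |>.2 fun _ => hx
  -- Nikaido–Isoda function: the total payoff when each agent separately deviates from `s` to its
  -- part of `t`.
  obtain ⟨s, hs, hmax⟩ := exists_forall_le_diag (K := univ.pi S)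
    (F := fun s t => ∑ i, u i (Function.update s i (t i)))
    (convex_pi fun i _ => hconv i) (isCompact_univ_pi hcomp) (univ_pi_nonempty_iff.2 hne)
    (continuousOn_finsetSum _ fun i _ => (hu i).comp
      (f := fun p : (∀ i, E i) × (∀ i, E i) => Function.update p.1 i (p.2 i))
      (continuous_fst.update i ((continuous_apply i).comp continuous_snd)).continuousOn
      fun p hp => hupd _ hp.1 i _ (hp.2 i (mem_univ i)))
    (fun s hs => by
      refine ⟨convex_pi fun i _ => hconv i, fun t ht t' ht' a b ha hb hab => ?_⟩
      simp only [smul_eq_mul, Finset.mul_sum, ← Finset.sum_add_distrib]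
      exact Finset.sum_le_sum fun i _ =>
        (hconc i s hs).2 (ht i (mem_univ i)) (ht' i (mem_univ i)) ha hb hab)
  refine ⟨s, hs, fun i x hx => ?_⟩
  -- When `t` differs from `s` only in coordinate `i`, all other summands cancel.
  have := hmax _ (hupd s hs i x hx)
  simp only [Function.update_eq_self] at this
  rw [← Finset.add_sum_erase _ _ (Finset.mem_univ i),
    ← Finset.add_sum_erase _ (fun j => u j s) (Finset.mem_univ i), Function.update_self,
    Finset.sum_congr rfl fun j hj => by
      rw [Function.update_of_ne (Finset.ne_of_mem_erase hj), Function.update_eq_self]] at this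
  exact le_of_add_le_add_right this

/-! ### Worst-case expectations over distributions on a compact set -/

namespace DRGame

variable {m : ℕ} {Ξ : Set (EuclideanSpace ℝ (Fin m))}

theorem ae_mem_of_mem_distributionsOn {Q : Measure (EuclideanSpace ℝ (Fin m))}
    (hQ : Q ∈ distributionsOn Ξ) : ∀ᵐ ξ ∂Q, ξ ∈ Ξ :=
  hQ.2.1

theorem integrable_of_continuousOn (hΞ : IsCompact Ξ) {Q : Measure (EuclideanSpace ℝ (Fin m))}
    (hQ : Q ∈ distributionsOn Ξ) {g : EuclideanSpace ℝ (Fin m) → ℝ} (hg : ContinuousOn g Ξ) :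
    Integrable g Q := by
  have := hQ.1
  have h := hg.integrableOn_compact (μ := Q) hΞ
  rwa [IntegrableOn, Measure.restrict_eq_self_of_ae_mem (ae_mem_of_mem_distributionsOn hQ)] at h

theorem bddBelow_range_integral (hΞ : IsCompact Ξ)
    {𝒬 : Set (Measure (EuclideanSpace ℝ (Fin m)))} (h𝒬 : 𝒬 ⊆ distributionsOn Ξ)
    {g : EuclideanSpace ℝ (Fin m) → ℝ} (hg : ContinuousOn g Ξ) :
    BddBelow (range fun Q : 𝒬 => ∫ ξ, g ξ ∂Q.1) := by
  obtain ⟨C, hC⟩ := (hΞ.image_of_continuousOn hg).bddBelow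
  refine ⟨C, ?_⟩
  rintro _ ⟨Q, rfl⟩
  have := (h𝒬 Q.2).1
  have h : ∫ _, C ∂Q.1 ≤ ∫ ξ, g ξ ∂Q.1 := integral_mono_ae (integrable_const _)
    (integrable_of_continuousOn hΞ (h𝒬 Q.2) hg)
    ((ae_mem_of_mem_distributionsOn (h𝒬 Q.2)).mono fun ξ hξ => hC (mem_image_of_mem g hξ))
  simpa using h

/-- The modulus of continuity of `u` is uniform over `Ξ`, hence survives averaging against any
probability on `Ξ` and then the infimum. -/
theorem continuousOn_iInf_integral {E : Type*} [PseudoMetricSpace E] {K : Set E}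
    (hK : IsCompact K) (hΞ : IsCompact Ξ) {u : E → EuclideanSpace ℝ (Fin m) → ℝ}
    (hu : ContinuousOn (fun p : E × EuclideanSpace ℝ (Fin m) => u p.1 p.2) (K ×ˢ Ξ))
    {𝒬 : Set (Measure (EuclideanSpace ℝ (Fin m)))} (h𝒬 : 𝒬 ⊆ distributionsOn Ξ) :
    ContinuousOn (fun s => ⨅ Q : 𝒬, ∫ ξ, u s ξ ∂Q.1) K := by
  have hus : ∀ s ∈ K, ContinuousOn (u s) Ξ := fun s hs =>
    hu.comp (f := fun ξ => (s, ξ)) (by fun_prop) fun ξ hξ => ⟨hs, hξ⟩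
  rcases isEmpty_or_nonempty 𝒬 with h | h
  -- The real infimum over the empty family is the constant `0`.
  · simp only [Real.iInf_of_isEmpty]
    exact continuousOn_const
  rw [Metric.continuousOn_iff]
  intro s hs δ hδ
  obtain ⟨η, hη, huc⟩ := Metric.uniformContinuousOn_iff.1
    ((hK.prod hΞ).uniformContinuousOn_of_continuous hu) (δ / 2) (half_pos hδ)
  have hint : ∀ t ∈ K, ∀ t' ∈ K, dist t t' < η → ∀ Q : 𝒬,
      ∫ ξ, u t ξ ∂Q.1 ≤ ∫ ξ, u t' ξ ∂Q.1 + δ / 2 := by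
    intro t ht t' ht' hd Q
    have := (h𝒬 Q.2).1
    have hi' := integrable_of_continuousOn hΞ (h𝒬 Q.2) (hus t' ht')
    have h : ∫ ξ, u t ξ ∂Q.1 ≤ ∫ ξ, (u t' ξ + δ / 2) ∂Q.1 := integral_mono_ae
      (integrable_of_continuousOn hΞ (h𝒬 Q.2) (hus t ht)) (hi'.add (integrable_const _))
      ((ae_mem_of_mem_distributionsOn (h𝒬 Q.2)).mono fun ξ hξ => by
        have := (abs_lt.1 (huc (t, ξ) ⟨ht, hξ⟩ (t', ξ) ⟨ht', hξ⟩
          (by rwa [dist_prod_same_right]))).2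
        simp only at this ⊢
        linarith)
    rw [integral_add hi' (integrable_const _)] at h
    simpa using h
  have hinf : ∀ t ∈ K, ∀ t' ∈ K, dist t t' < η →
      ⨅ Q : 𝒬, ∫ ξ, u t ξ ∂Q.1 ≤ (⨅ Q : 𝒬, ∫ ξ, u t' ξ ∂Q.1) + δ / 2 := by
    intro t ht t' ht' hd
    rw [← sub_le_iff_le_add]
    refine le_ciInf fun Q => ?_
    rw [sub_le_iff_le_add]
    exact (ciInf_le (bddBelow_range_integral hΞ h𝒬 (hus t ht)) Q).trans (hint t ht t' ht' hd Q)
  refine ⟨η, hη, fun t ht hd => ?_⟩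
  have h1 := hinf t ht s hs hd
  have h2 := hinf s hs t ht (by rwa [dist_comm])
  rw [Real.dist_eq, abs_lt]
  constructor <;> linarith

theorem concaveOn_iInf_integral {V : Type*} [AddCommGroup V] [Module ℝ V] {A : Set V}
    (hA : Convex ℝ A) (hΞ : IsCompact Ξ) {u : V → EuclideanSpace ℝ (Fin m) → ℝ}
    (hu : ∀ x ∈ A, ContinuousOn (u x) Ξ) (hconc : ∀ ξ ∈ Ξ, ConcaveOn ℝ A fun x => u x ξ)
    {𝒬 : Set (Measure (EuclideanSpace ℝ (Fin m)))} (h𝒬 : 𝒬 ⊆ distributionsOn Ξ) :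
    ConcaveOn ℝ A fun x => ⨅ Q : 𝒬, ∫ ξ, u x ξ ∂Q.1 := by
  rcases isEmpty_or_nonempty 𝒬 with h | h
  · simp only [Real.iInf_of_isEmpty]
    exact concaveOn_const 0 hA
  refine ⟨hA, fun x hx y hy a b ha hb hab => le_ciInf fun Q => ?_⟩
  have hix := (integrable_of_continuousOn hΞ (h𝒬 Q.2) (hu x hx)).const_mul a
  have hiy := (integrable_of_continuousOn hΞ (h𝒬 Q.2) (hu y hy)).const_mul b
  calc a • (⨅ Q : 𝒬, ∫ ξ, u x ξ ∂Q.1) + b • ⨅ Q : 𝒬, ∫ ξ, u y ξ ∂Q.1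
      ≤ a * ∫ ξ, u x ξ ∂Q.1 + b * ∫ ξ, u y ξ ∂Q.1 := add_le_add
        (mul_le_mul_of_nonneg_left (ciInf_le (bddBelow_range_integral hΞ h𝒬 (hu x hx)) Q) ha)
        (mul_le_mul_of_nonneg_left (ciInf_le (bddBelow_range_integral hΞ h𝒬 (hu y hy)) Q) hb)
    _ = ∫ ξ, (a * u x ξ + b * u y ξ) ∂Q.1 := by
        rw [integral_add hix hiy, integral_const_mul, integral_const_mul]
    _ ≤ ∫ ξ, u (a • x + b • y) ξ ∂Q.1 := integral_mono_ae (hix.add hiy)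
        (integrable_of_continuousOn hΞ (h𝒬 Q.2) (hu _ (hA hx hy ha hb hab)))
        ((ae_mem_of_mem_distributionsOn (h𝒬 Q.2)).mono fun ξ hξ =>
          (hconc ξ hξ).2 hx hy ha hb hab)

/-- Existence of equilibria when each agent `i` maximizes its worst expected utility over a set
`𝒬 i` of distributions on a compact set. -/
theorem exists_worstCase_equilibrium {n : ℕ} {d : Fin n → ℕ}
    {S : ∀ i, Set (EuclideanSpace ℝ (Fin (d i)))} (hne : ∀ i, (S i).Nonempty)
    (hconv : ∀ i, Convex ℝ (S i)) (hcomp : ∀ i, IsCompact (S i)) (hΞ : IsCompact Ξ)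
    {U : Fin n → Profile d → EuclideanSpace ℝ (Fin m) → ℝ}
    (hU : ∀ i, ContinuousOn
      (fun p : Profile d × EuclideanSpace ℝ (Fin m) => U i p.1 p.2) (univ.pi S ×ˢ Ξ))
    (hconc : ∀ i, ∀ s ∈ univ.pi S, ∀ ξ ∈ Ξ,
      ConcaveOn ℝ (S i) (fun x => U i (Function.update s i x) ξ))
    {𝒬 : Fin n → Set (Measure (EuclideanSpace ℝ (Fin m)))}
    (h𝒬 : ∀ i, 𝒬 i ⊆ distributionsOn Ξ) :
    ∃ s ∈ univ.pi S, ∀ i, ∀ x ∈ S i,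
      ⨅ Q : 𝒬 i, ∫ ξ, U i (Function.update s i x) ξ ∂Q.1 ≤ ⨅ Q : 𝒬 i, ∫ ξ, U i s ξ ∂Q.1 :=
  exists_nash_equilibrium (u := fun i s => ⨅ Q : 𝒬 i, ∫ ξ, U i s ξ ∂Q.1) hne hconv hcomp
    (fun i => continuousOn_iInf_integral (isCompact_univ_pi hcomp) hΞ (hU i) (h𝒬 i))
    fun i s hs => concaveOn_iInf_integral (hconv i) hΞ
      (fun x hx => (hU i).comp (f := fun ξ => (Function.update s i x, ξ)) (by fun_prop)
        fun ξ hξ => ⟨update_mem_pi_iff_of_mem hs |>.2 fun _ => hx, hξ⟩)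
      (hconc i s hs) (h𝒬 i)

end DRGame

/-! ### Equilibria of the two games -/

theorem EReal.biInf_coe_eq {α : Type*} {s : Set α} (hs : s.Nonempty) {g : α → ℝ}
    (hg : BddBelow (range fun a : s => g a)) :
    ⨅ a ∈ s, (g a : EReal) = ((⨅ a : s, g a : ℝ) : EReal) := by
  have := hs.to_subtype
  refine le_antisymm ?_ (le_iInf₂ fun a ha => EReal.coe_le_coe_iff.2 (ciInf_le hg ⟨a, ha⟩))
  refine EReal.le_of_forall_lt_iff_le.1 fun z hz => ?_
  obtain ⟨a, ha⟩ := exists_lt_of_ciInf_lt (EReal.coe_lt_coe_iff.1 hz)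
  exact (iInf₂_le a.1 a.2).trans (EReal.coe_le_coe_iff.2 ha.le)

theorem mainTheorem5 {n m N : ℕ} (d : Fin n → ℕ)
    (S : ∀ i, Set (EuclideanSpace ℝ (Fin (d i))))
    (hS_nonempty : ∀ i, (S i).Nonempty)
    (hS_convex : ∀ i, Convex ℝ (S i))
    (hS_compact : ∀ i, IsCompact (S i))
    (Ξ : Set (EuclideanSpace ℝ (Fin m))) (hΞ : IsCompact Ξ)
    (U : Fin n → DRGame.Profile d → EuclideanSpace ℝ (Fin m) → ℝ)
    (hU_cont : ∀ i, ContinuousOn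
      (fun p : DRGame.Profile d × EuclideanSpace ℝ (Fin m) => U i p.1 p.2)
      (Set.pi univ S ×ˢ Ξ))
    (hU_concave : ∀ i, ∀ s ∈ Set.pi univ S, ∀ ξ ∈ Ξ,
      ConcaveOn ℝ (S i) (fun x => U i (Function.update s i x) ξ))
    (L : Fin n → ℝ≥0)
    (hU_lipschitz : ∀ i, ∀ s ∈ Set.pi univ S, LipschitzOnWith (L i) (U i s) Ξ)
    (Pstar : Measure (EuclideanSpace ℝ (Fin m)))
    (hPstar : Pstar ∈ DRGame.distributionsOn Ξ)
    (h : EuclideanSpace ℝ (Fin m) → EuclideanSpace ℝ (Fin m))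
    (hN : 0 < N) (ξs : Fin N → EuclideanSpace ℝ (Fin m))
    (ε : Fin n → ℝ) (hε : ∀ i, 0 ≤ ε i) :
    (DRGame.robustGame S Ξ U (DRGame.sampleAverage h ξs) ε).nashEquilibria.Nonempty ∧
      (DRGame.stochasticGame S U Pstar).nashEquilibria.Nonempty := by
  have hcont : ∀ i, ∀ s ∈ univ.pi S, ContinuousOn (U i s) Ξ := fun i s hs =>
    (hU_cont i).comp (f := fun ξ => (s, ξ)) (by fun_prop) fun ξ hξ => ⟨hs, hξ⟩
  constructor
  · have hball : ∀ i, DRGame.wassersteinBall Ξ (DRGame.sampleAverage h ξs) (ε i) ⊆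
        DRGame.distributionsOn Ξ := fun i Q hQ => hQ.1
    obtain ⟨s, hs, hmax⟩ := DRGame.exists_worstCase_equilibrium hS_nonempty hS_convex hS_compact
      hΞ hU_cont hU_concave hball
    refine ⟨s, hs, fun i x hx => ?_⟩
    rcases (DRGame.wassersteinBall Ξ (DRGame.sampleAverage h ξs) (ε i)).eq_empty_or_nonempty
      with he | hne
    -- An empty ball gives payoff `⊤` at every profile, so no deviation gains.
    · simp [DRGame.robustGame, he]
    · have hcoe : ∀ t ∈ univ.pi S, ⨅ Q ∈ DRGame.wassersteinBall Ξ (DRGame.sampleAverage h ξs) (ε i),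
          ((∫ ξ, U i t ξ ∂Q : ℝ) : EReal) = _ := fun t ht =>
        EReal.biInf_coe_eq hne (DRGame.bddBelow_range_integral hΞ (hball i) (hcont i t ht))
      change ⨅ Q ∈ _, _ ≤ ⨅ Q ∈ _, _
      rw [hcoe _ (update_mem_pi_iff_of_mem hs |>.2 fun _ => hx), hcoe s hs]
      exact EReal.coe_le_coe_iff.2 (hmax i x hx)
  -- An expectation is the infimum over a singleton.
  · obtain ⟨s, hs, hmax⟩ := DRGame.exists_worstCase_equilibrium hS_nonempty hS_convex hS_compact
      hΞ hU_cont hU_concave (𝒬 := fun _ => {Pstar}) fun _ => singleton_subset_iff.2 hPstar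
    refine ⟨s, hs, fun i x hx => ?_⟩
    have := hmax i x hx
    simp only [ciInf_unique, default_coe_singleton] at this
    exact this
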